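/- Fix an integer $m\ge1$ and a real number $\alpha>0$. For each integer $N\ge1$ put $$A_N=\sum_{j=1}^N j^{-\alpha},\qquad p_{N,j}=\frac{j^{-\alpha}}{A_N}\quad(1\le j\le N),$$ and let coupons be drawn independently, each draw yielding type $j\in\{1,\dots,N\}$ with probability $p_{N,j}$. Let $T_m(N)$ be the number of draws needed until each of the $N$ coupon types has been drawn at least $m$ times (this number is almost surely finite). Put $$C_N=A_NN^{\alpha},\qquad \rho_N=\log\frac N\alpha ,$$ and, for $N>\alpha$ (so that $\rho_N>0$), $$B_N=C_N\bigl[\rho_N+(m-2)\log\rho_N-\log((m-1)!)\bigr].$$ Then, as $N\to\infty$, $$\frac{T_m(N)-B_N}{C_N}\Rightarrow G$$ in distribution, where $G$ has the standard Gumbel law, $\mathbb P(G\le x)=\exp(-e^{-x})$ for all $x\in\mathbb R$. -/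

import Mathlib

open MeasureTheory ProbabilityTheory Filter Topology

/-- The distribution function `x ↦ exp (-exp (-x))` of the standard Gumbel law. -/
noncomputable def gumbelCDF : StieltjesFunction ℝ where
  toFun x := Real.exp (-Real.exp (-x))
  mono' x y h := Real.exp_le_exp.2 (neg_le_neg (Real.exp_le_exp.2 (neg_le_neg h)))
  right_continuous' x := by fun_prop

/-- The standard Gumbel law: the measure on `ℝ` with distribution function
`x ↦ exp (-exp (-x))`. -/
noncomputable def gumbelMeasure : Measure ℝ := gumbelCDF.measure

instance isProbabilityMeasure_gumbelMeasure : IsProbabilityMeasure gumbelMeasure := by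
  refine StieltjesFunction.isProbabilityMeasure gumbelCDF ?_ ?_
  · exact Real.tendsto_exp_atBot.comp (tendsto_neg_atTop_atBot.comp
      (Real.tendsto_exp_atTop.comp tendsto_neg_atBot_atTop))
  · have h : Tendsto (fun x : ℝ => Real.exp (-Real.exp (-x))) atTop (𝓝 (Real.exp (-0))) :=
      (Real.continuous_exp.tendsto _).comp (Tendsto.neg
        (Real.tendsto_exp_atBot.comp tendsto_neg_atTop_atBot))
    rw [neg_zero, Real.exp_zero] at h
    exact h

/-- `CollectedBy m x n`: among the first `n` draws `x 0, …, x (n - 1)`, every coupon type occurs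
at least `m` times. -/
def CollectedBy {ι : Type*} [DecidableEq ι] (m : ℕ) (x : ℕ → ι) (n : ℕ) : Prop :=
  ∀ j : ι, m ≤ ((Finset.range n).filter (fun k => x k = j)).card

/-- The number of draws needed to collect at least `m` copies of every coupon type along the
sequence of draws `x` (with value `0` if this never happens). -/
noncomputable def collectionTime {ι : Type*} [DecidableEq ι] (m : ℕ) (x : ℕ → ι) : ℕ :=
  sInf {n : ℕ | CollectedBy m x n}

/-- `A_N = ∑_{j=1}^N j^{-α}`. -/
noncomputable def powerLawNorm (α : ℝ) (N : ℕ) : ℝ :=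
  ∑ j ∈ Finset.Icc 1 N, (j : ℝ) ^ (-α)

/-- `p_{N,j} = j^{-α} / A_N` for `1 ≤ j ≤ N`; the element `i` of `Fin N` is the coupon type
`j = i + 1`. -/
noncomputable def powerLawProb (α : ℝ) (N : ℕ) (i : Fin N) : ℝ :=
  (((i : ℕ) + 1 : ℕ) : ℝ) ^ (-α) / powerLawNorm α N

/-- `C_N = A_N N^α`. -/
noncomputable def powerLawScale (α : ℝ) (N : ℕ) : ℝ :=
  powerLawNorm α N * (N : ℝ) ^ α

/-- `ρ_N = log (N / α)`. -/
noncomputable def powerLawRho (α : ℝ) (N : ℕ) : ℝ :=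
  Real.log ((N : ℝ) / α)

/-- `B_N = C_N [ρ_N + (m - 2) log ρ_N - log ((m - 1)!)]`. -/
noncomputable def powerLawCenter (m : ℕ) (α : ℝ) (N : ℕ) : ℝ :=
  powerLawScale α N *
    (powerLawRho α N + ((m : ℝ) - 2) * Real.log (powerLawRho α N)
      - Real.log (((m - 1).factorial : ℕ) : ℝ))

/-! Poissonization. If the number of draws is Poisson with mean `C_N t`, the counts are independent
Poisson variables with means `t (j/N)^(-α)`, so the collection is complete with probability `∏ j, (1
- q_j)`, where `q_j = poissonBelow m (t (j/N)^(-α))`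
(`lintegral_measure_collectedBy_poissonMeasure`). Only types with `j` within order `N/t` of `N`
matter: putting `j/N = 1 - w/t` gives `∑ q_j ≈ (N/t) ∫ poissonBelow m (t + α w) dw ≈ N t^(m-2)
e^(-t) / (α (m-1)!)` (`tendsto_sum_poissonBelow_rpow`). The centring `B_N` is the choice of `t` for
which this tends to `e^(-x)` (`tendsto_powerLawTime_exp`). As the `q_j` are uniformly small, the
product tends to `exp (-e^(-x))` (`tendsto_prod_one_sub`).

Returning to a deterministic number of draws costs little: completeness is monotone in that number,
and since `C_N ≥ N` while `t` is of order `log N`, a Poisson variable with mean `C_N t` lies within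
`ε C_N / 2` of its mean with probability tending to one (`measureReal_collectedBy_bounds`). Shifting
`x` by `ε` and using continuity of the limit finishes. -/

/-! ### Occurrence counts and the multinomial law -/

/-- The number of times each type occurs among the first `n` terms of `x`. -/
def occurrences {ι : Type*} [DecidableEq ι] (x : ℕ → ι) (n : ℕ) (j : ι) : ℕ :=
  ((Finset.range n).filter (fun k => x k = j)).card

theorem occurrences_succ {ι : Type*} [DecidableEq ι] (x : ℕ → ι) (n : ℕ) (j : ι) :
    occurrences x (n + 1) j = occurrences x n j + if x n = j then 1 else 0 := by
  unfold occurrences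
  rw [Finset.range_add_one, Finset.filter_insert]
  split_ifs <;> simp

theorem occurrences_mono {ι : Type*} [DecidableEq ι] (x : ℕ → ι) (j : ι) :
    Monotone fun n => occurrences x n j :=
  monotone_nat_of_le_succ fun n => by simp [occurrences_succ]

theorem sum_occurrences {ι : Type*} [DecidableEq ι] [Fintype ι] (x : ℕ → ι) (n : ℕ) :
    ∑ j, occurrences x n j = n := by
  induction n with
  | zero => simp [occurrences]
  | succ n ih => simp [occurrences_succ, Finset.sum_add_distrib, ih]

theorem measurableSet_draw_eq {ι Ω : Type*} [MeasurableSpace ι] [MeasurableSingletonClass ι]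
    [MeasurableSpace Ω] {X : ℕ → Ω → ι} (hX : ∀ k, Measurable (X k)) (k : ℕ) (j : ι) :
    MeasurableSet {ω | X k ω = j} :=
  hX k (measurableSet_singleton j)

theorem measurable_occurrences {ι Ω : Type*} [DecidableEq ι] [MeasurableSpace ι]
    [MeasurableSingletonClass ι] [MeasurableSpace Ω] {X : ℕ → Ω → ι}
    (hX : ∀ k, Measurable (X k)) (n : ℕ) :
    Measurable fun ω => occurrences (fun k => X k ω) n := by
  refine measurable_pi_lambda _ fun j => ?_
  induction n with
  | zero => simp [occurrences]
  | succ n ih =>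
    simp_rw [occurrences_succ]
    exact ih.add (Measurable.ite (measurableSet_draw_eq hX n j) measurable_const measurable_const)

section Sampling

variable {ι : Type*} [Fintype ι] [DecidableEq ι] [MeasurableSpace ι] [MeasurableSingletonClass ι]
  {Ω : Type*} [MeasurableSpace Ω] {P : Measure Ω} {X : ℕ → Ω → ι}

/-- The counts are a function of the draws with index below `n`, a block disjoint from `{n}`. -/
theorem indepFun_occurrences_draw (hX : ∀ k, Measurable (X k)) (hI : iIndepFun X P) (n : ℕ) :
    IndepFun (fun ω => occurrences (fun k => X k ω) n) (X n) P := by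
  have h := hI.indepFun_finset (Finset.range n) {n} (by simp) hX
  have h2 := h.comp (φ := fun y j => ∑ k : Finset.range n, if y k = j then 1 else 0)
    (ψ := fun y => y ⟨n, by simp⟩) (measurable_of_finite _) (measurable_of_finite _)
  suffices e : (fun ω => occurrences (fun k => X k ω) n)
      = (fun (y : Finset.range n → ι) j => ∑ k : Finset.range n, if y k = j then 1 else 0)
        ∘ fun ω (k : Finset.range n) => X k ω by
    rw [e]
    exact h2
  ext ω j
  simp only [occurrences, Function.comp_apply, Finset.card_filter]
  exact (Finset.sum_coe_sort (Finset.range n) fun k => if X k ω = j then 1 else 0).symm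

/-- The counts of i.i.d. draws have the multinomial law. -/
theorem measureReal_occurrences_eq [IsProbabilityMeasure P] (hX : ∀ k, Measurable (X k)) (hI : iIndepFun X P)
    {p : ι → ℝ} (hp : ∀ k j, P.real {ω | X k ω = j} = p j) (n : ℕ) (c : ι → ℕ)
    (hc : ∑ j, c j = n) :
    P.real {ω | occurrences (fun k => X k ω) n = c}
      = n.factorial * ∏ j, (p j ^ c j / (c j).factorial) := by
  induction n generalizing c with
  | zero =>
    have h0 : c = 0 := by
      ext j
      simpa using (Finset.sum_eq_zero_iff.1 hc) j (Finset.mem_univ j)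
    subst h0
    have : {ω | occurrences (fun k => X k ω) 0 = 0} = Set.univ := by
      ext ω
      simp only [Set.mem_ofPred_eq, Set.mem_univ, iff_true]
      ext j
      simp [occurrences]
    rw [this]
    simp
  | succ n ih =>
    set g : ℝ := ∏ j, (p j ^ c j / (c j).factorial) with hg
    -- Split according to the last draw: removing a draw of type `j` lowers `c j` by one, and the
    -- lost factor `p j / c j` accounts for the weight `c j`. Summing over `j` then turns `n!` into
    -- `(n + 1)!`.
    have key : ∀ j, P.real ({ω | occurrences (fun k => X k ω) (n + 1) = c} ∩ {ω | X n ω = j})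
        = n.factorial * (c j * g) := by
      intro j
      rcases Nat.eq_zero_or_pos (c j) with h0 | hpos
      · have : {ω | occurrences (fun k => X k ω) (n + 1) = c} ∩ {ω | X n ω = j} = ∅ := by
          ext ω
          simp only [Set.mem_inter_iff, Set.mem_ofPred_eq, Set.mem_empty_iff_false, iff_false,
            not_and]
          intro h h'
          have := congrFun h j
          rw [occurrences_succ, if_pos h', h0] at this
          omega
        rw [this, h0]
        simp
      · obtain ⟨d, hd⟩ : ∃ d, c j = d + 1 := ⟨c j - 1, by omega⟩
        have hset : {ω | occurrences (fun k => X k ω) (n + 1) = c} ∩ {ω | X n ω = j}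
            = {ω | occurrences (fun k => X k ω) n = Function.update c j d} ∩ {ω | X n ω = j} := by
          ext ω
          simp only [Set.mem_inter_iff, Set.mem_ofPred_eq, and_congr_left_iff]
          intro h
          simp only [funext_iff, occurrences_succ, h]
          refine forall_congr' fun i => ?_
          rcases eq_or_ne i j with rfl | hij
          · simp [hd]
          · simp [hij, hij.symm]
        have hind := (indepFun_occurrences_draw hX hI n).measure_inter_preimage_eq_mul
          {Function.update c j d} {j} (measurableSet_singleton _) (measurableSet_singleton _)
        have hsum : ∑ i, Function.update c j d i = n := by
          rw [Finset.sum_update_of_mem (Finset.mem_univ j)]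
          rw [← Finset.add_sum_erase _ _ (Finset.mem_univ j), hd] at hc
          rw [Finset.sdiff_singleton_eq_erase]
          omega
        have e : P.real {ω | occurrences (fun k => X k ω) n = Function.update c j d}
            = n.factorial * ∏ i, (p i ^ (Function.update c j d i)
              / (Function.update c j d i).factorial) := ih _ hsum
        rw [hset]
        have hind' := congrArg ENNReal.toReal hind
        rw [ENNReal.toReal_mul] at hind'
        refine hind'.trans ?_
        change P.real {ω | occurrences (fun k => X k ω) n = Function.update c j d} *
          P.real {ω | X n ω = j} = _
        rw [e, hp, mul_assoc]
        congr 1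
        rw [hg, ← Finset.mul_prod_erase _ _ (Finset.mem_univ j),
          ← Finset.mul_prod_erase _ (fun i => p i ^ c i / _) (Finset.mem_univ j)]
        have : ∏ i ∈ Finset.univ.erase j, (p i ^ (Function.update c j d i)
              / ((Function.update c j d i).factorial : ℝ))
            = ∏ i ∈ Finset.univ.erase j, (p i ^ c i / ((c i).factorial : ℝ)) :=
          Finset.prod_congr rfl fun i hi => by
            rw [Function.update_of_ne (Finset.ne_of_mem_erase hi)]
        rw [this, Function.update_self, hd, Nat.factorial_succ]
        push_cast
        field_simp
        ring
    have hsplit : P.real {ω | occurrences (fun k => X k ω) (n + 1) = c}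
        = ∑ j, P.real ({ω | occurrences (fun k => X k ω) (n + 1) = c} ∩ {ω | X n ω = j}) := by
      rw [← measureReal_biUnion_finset]
      · congr 1
        ext ω
        simp
      · intro i _ j _ hij
        refine Set.disjoint_left.2 fun ω h1 h2 => hij (h1.2.symm.trans h2.2)
      · intro j _
        exact (measurable_occurrences hX (n + 1) (measurableSet_singleton c)).inter
          (measurableSet_draw_eq hX n j)
    rw [hsplit]
    simp_rw [key]
    rw [← Finset.mul_sum, ← Finset.sum_mul, ← Nat.cast_sum, hc, Nat.factorial_succ]
    push_cast
    ring

/-! ### Poissonization and comparison with a fixed number of draws -/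

open scoped NNReal in
/-- Poissonization: if the number of draws is Poisson with mean `s`, the counts of the types are
independent Poisson variables with means `s * p j`. -/
theorem lintegral_measure_collectedBy_poissonMeasure [IsProbabilityMeasure P]
    (hX : ∀ k, Measurable (X k)) (hI : iIndepFun X P)
    {p : ι → ℝ≥0} (hp : ∀ k j, P.real {ω | X k ω = j} = p j) (hp1 : ∑ j, p j = 1)
    (m : ℕ) (s : ℝ≥0) :
    ∫⁻ n, P {ω | CollectedBy m (fun k => X k ω) n} ∂(poissonMeasure s)
      = ∏ j, poissonMeasure (s * p j) (Set.Ici m) := by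
  set μ : Measure (ι → ℕ) := Measure.pi fun j => poissonMeasure (s * p j) with hμ
  rw [← Measure.pi_pi, ← hμ, lintegral_countable']
  set A : Set (ι → ℕ) := Set.univ.pi fun _ => Set.Ici m
  -- Slicing the product law by the total count matches the sum over `n` on the left; each slice is
  -- finite, so the identity reduces to single count vectors.
  have hA : A = ⋃ n : ℕ, A ∩ {c | ∑ j, c j = n} := by
    ext c
    simp
  rw [hA, measure_iUnion]
  rotate_left
  · intro i j hij
    exact Set.disjoint_left.2 fun c h1 h2 => hij (h1.2.symm.trans h2.2)
  · exact fun n => MeasurableSet.of_discrete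
  refine tsum_congr fun n => ?_
  set F : Finset (ι → ℕ) :=
    (Finset.piAntidiag Finset.univ n).filter (fun c => ∀ j, m ≤ c j) with hF
  have h1 : A ∩ {c | ∑ j, c j = n} = (F : Set (ι → ℕ)) := by
    ext c
    simp [A, hF, and_comm, Pi.le_def]
  have h2 : {ω | CollectedBy m (fun k => X k ω) n}
      = (fun ω => occurrences (fun k => X k ω) n) ⁻¹' (F : Set (ι → ℕ)) := by
    ext ω
    simp [hF, sum_occurrences, CollectedBy, occurrences]
  rw [h1, h2, ← sum_measure_singleton,
    ← sum_measure_preimage_singleton F fun c _ =>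
      measurable_occurrences hX n (measurableSet_singleton c), Finset.sum_mul]
  refine Finset.sum_congr rfl fun c hc => ?_
  have hcn : ∑ j, c j = n := by
    simp only [hF, Finset.mem_filter, Finset.mem_piAntidiag] at hc
    exact hc.1.1
  rw [← ENNReal.toReal_eq_toReal_iff' (ENNReal.mul_ne_top (measure_ne_top _ _) (measure_ne_top _ _))
    (measure_ne_top _ _), ENNReal.toReal_mul, hμ, Measure.pi_singleton, ENNReal.toReal_prod]
  have e1 := measureReal_occurrences_eq hX hI (p := fun j => (p j : ℝ)) hp n c hcn
  have e2 := poissonMeasure_real_singleton s n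
  have e3 : ∀ j, (poissonMeasure (s * p j) {c j}).toReal
      = Real.exp (-(s * p j)) * (s * p j) ^ c j / (c j).factorial := fun j => by
    rw [← measureReal_def, poissonMeasure_real_singleton, NNReal.coe_mul]
  refine (congrArg₂ (· * ·) e1 e2).trans ?_
  simp_rw [e3]
  have hs : ∏ j, Real.exp (-(s * p j)) = Real.exp (-s) := by
    rw [← Real.exp_sum, Finset.sum_neg_distrib, ← Finset.mul_sum]
    congr 2
    have : ∑ j, (p j : ℝ) = 1 := by exact_mod_cast hp1
    rw [this, mul_one]
  have hs2 : ∏ j, (s : ℝ) ^ c j = (s : ℝ) ^ n := by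
    rw [Finset.prod_pow_eq_pow_sum, hcn]
  simp_rw [mul_pow, Finset.prod_div_distrib, Finset.prod_mul_distrib]
  rw [hs, hs2]
  have := Nat.factorial_ne_zero n
  field_simp

-- If the Poisson number of draws is below `n`, completeness at that number forces completeness at
-- `n`; the tail term pays for the other case. The next lemma is the mirror image.
open scoped NNReal in
theorem prod_poissonMeasure_le [IsProbabilityMeasure P]
    (hX : ∀ k, Measurable (X k)) (hI : iIndepFun X P)
    {p : ι → ℝ≥0} (hp : ∀ k j, P.real {ω | X k ω = j} = p j) (hp1 : ∑ j, p j = 1)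
    (m : ℕ) (s : ℝ≥0) (n : ℕ) :
    ∏ j, (poissonMeasure (s * p j)).real (Set.Ici m)
      ≤ P.real {ω | CollectedBy m (fun k => X k ω) n} + (poissonMeasure s).real (Set.Ici n) := by
  have h := lintegral_measure_collectedBy_poissonMeasure hX hI hp hp1 m s
  simp_rw [measureReal_def]
  rw [← ENNReal.toReal_prod, ← h, ← ENNReal.toReal_add (measure_ne_top _ _) (measure_ne_top _ _)]
  refine ENNReal.toReal_mono (by simp) ?_
  calc ∫⁻ k, P {ω | CollectedBy m (fun k => X k ω) k} ∂(poissonMeasure s)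
      ≤ ∫⁻ k, (P {ω | CollectedBy m (fun k => X k ω) n}
          + (Set.Ici n).indicator 1 k) ∂(poissonMeasure s) := by
        refine lintegral_mono fun k => ?_
        by_cases hk : n ≤ k
        · simpa [hk] using prob_le_one.trans le_add_self
        · refine le_add_right (measure_mono fun ω hω j => (hω j).trans ?_)
          exact occurrences_mono (fun k => X k ω) j (by omega : k ≤ n)
    _ = _ := by
        rw [lintegral_add_left (by fun_prop), lintegral_indicator_one (measurableSet_Ici)]
        simp

open scoped NNReal in
theorem measureReal_collectedBy_le [IsProbabilityMeasure P]
    (hX : ∀ k, Measurable (X k)) (hI : iIndepFun X P)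
    {p : ι → ℝ≥0} (hp : ∀ k j, P.real {ω | X k ω = j} = p j) (hp1 : ∑ j, p j = 1)
    (m : ℕ) (s : ℝ≥0) (n : ℕ) :
    P.real {ω | CollectedBy m (fun k => X k ω) n}
      ≤ ∏ j, (poissonMeasure (s * p j)).real (Set.Ici m) + (poissonMeasure s).real (Set.Iic n) := by
  have h := lintegral_measure_collectedBy_poissonMeasure hX hI hp hp1 m s
  simp_rw [measureReal_def]
  rw [← ENNReal.toReal_prod, ← h, ← ENNReal.toReal_add _ (measure_ne_top _ _)]
  rotate_left
  · rw [h]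
    exact ENNReal.prod_ne_top fun j _ => measure_ne_top _ _
  refine ENNReal.toReal_mono (ENNReal.add_ne_top.2 ⟨?_, measure_ne_top _ _⟩) ?_
  · rw [h]
    exact ENNReal.prod_ne_top fun j _ => measure_ne_top _ _
  calc P {ω | CollectedBy m (fun k => X k ω) n}
      = ∫⁻ _, P {ω | CollectedBy m (fun k => X k ω) n} ∂(poissonMeasure s) := by simp
    _ ≤ ∫⁻ k, (P {ω | CollectedBy m (fun k => X k ω) k}
          + (Set.Iic n).indicator 1 k) ∂(poissonMeasure s) := by
        refine lintegral_mono fun k => ?_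
        by_cases hk : k ≤ n
        · simpa [hk] using prob_le_one.trans le_add_self
        · refine le_add_right (measure_mono fun ω hω j => (hω j).trans ?_)
          exact occurrences_mono (fun k => X k ω) j (by omega : n ≤ k)
    _ = _ := by
        rw [lintegral_add_left (measurable_of_countable _),
          lintegral_indicator_one (measurableSet_Iic)]

end Sampling

/-! ### Chernoff bounds for the Poisson law -/

section PoissonTail

open scoped NNReal

theorem hasSum_poissonMeasure_exp_mul (s : ℝ≥0) (h : ℝ) :
    HasSum (fun n : ℕ => Real.exp (-s) * s ^ n / n.factorial * Real.exp (h * n))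
      (Real.exp (s * (Real.exp h - 1))) := by
  have := (NormedSpace.expSeries_div_hasSum_exp (s * Real.exp h : ℝ)).mul_left (Real.exp (-s))
  rw [← Real.exp_eq_exp_ℝ, ← Real.exp_add] at this
  have e1 : (s : ℝ) * (Real.exp h - 1) = -s + s * Real.exp h := by ring
  have e2 : (fun n : ℕ => Real.exp (-s) * s ^ n / n.factorial * Real.exp (h * n))
      = fun n : ℕ => Real.exp (-s) * ((s * Real.exp h) ^ n / n.factorial) := by
    ext n
    rw [mul_pow, ← Real.exp_nat_mul, mul_comm h]
    ring
  rw [e1, e2]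
  exact this

theorem integrable_exp_mul_poissonMeasure (s : ℝ≥0) (h : ℝ) :
    Integrable (fun n : ℕ => Real.exp (h * n)) (poissonMeasure s) := by
  rw [integrable_poissonMeasure_iff]
  simpa using (hasSum_poissonMeasure_exp_mul s h).summable

theorem mgf_poissonMeasure (s : ℝ≥0) (h : ℝ) :
    mgf (fun n : ℕ => (n : ℝ)) (poissonMeasure s) h = Real.exp (s * (Real.exp h - 1)) := by
  rw [mgf, integral_poissonMeasure' (integrable_exp_mul_poissonMeasure s h)]
  exact (hasSum_poissonMeasure_exp_mul s h).tsum_eq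

/-- Chernoff's bound with parameter `h = d / (2 s)`, which minimizes `s h ^ 2 - h d`; the quadratic
bound on `exp h - 1 - h` is available because `d ≤ s` gives `h ≤ 1`. -/
theorem poissonMeasure_real_ge_le {s : ℝ≥0} (hs : 0 < s) {d a : ℝ} (hd : 0 ≤ d) (hds : d ≤ s)
    (ha : s + d ≤ a) :
    (poissonMeasure s).real {n | a ≤ (n : ℝ)} ≤ Real.exp (-(d ^ 2 / (4 * s))) := by
  have hs' : (0 : ℝ) < s := hs
  have h0 : 0 ≤ d / (2 * s) := by positivity
  have h1 : d / (2 * s) ≤ 1 := by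
    rw [div_le_one (by positivity)]
    linarith
  refine (measure_ge_le_exp_mul_mgf a h0 (integrable_exp_mul_poissonMeasure s _)).trans ?_
  rw [mgf_poissonMeasure, ← Real.exp_add, Real.exp_le_exp]
  have hq := (abs_le.1 (Real.abs_exp_sub_one_sub_id_le (x := d / (2 * s))
    (by rwa [abs_of_nonneg h0]))).2
  have e : d ^ 2 / (4 * s) = (d / (2 * s)) * d - s * (d / (2 * s)) ^ 2 := by
    field_simp
    ring
  rw [e]
  nlinarith [mul_le_mul_of_nonneg_left hq hs'.le, mul_le_mul_of_nonneg_left ha h0]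

theorem poissonMeasure_real_le_le {s : ℝ≥0} (hs : 0 < s) {d a : ℝ} (hd : 0 ≤ d) (hds : d ≤ s)
    (ha : a ≤ s - d) :
    (poissonMeasure s).real {n | (n : ℝ) ≤ a} ≤ Real.exp (-(d ^ 2 / (4 * s))) := by
  have hs' : (0 : ℝ) < s := hs
  have h0 : 0 ≤ d / (2 * s) := by positivity
  have h1 : d / (2 * s) ≤ 1 := by
    rw [div_le_one (by positivity)]
    linarith
  refine (measure_le_le_exp_mul_mgf a (neg_nonpos.2 h0)
    (integrable_exp_mul_poissonMeasure s _)).trans ?_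
  rw [mgf_poissonMeasure, ← Real.exp_add, Real.exp_le_exp]
  have hq := (abs_le.1 (Real.abs_exp_sub_one_sub_id_le (x := -(d / (2 * s)))
    (by rwa [abs_neg, abs_of_nonneg h0]))).2
  have e : d ^ 2 / (4 * s) = (d / (2 * s)) * d - s * (d / (2 * s)) ^ 2 := by
    field_simp
    ring
  rw [e]
  nlinarith [mul_le_mul_of_nonneg_left hq hs'.le, mul_le_mul_of_nonneg_left ha h0]

end PoissonTail

/-! ### The lower Poisson tail as a function of its mean -/

/-- The probability that a Poisson variable with mean `u` is less than `m`. -/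
noncomputable def poissonBelow (m : ℕ) (u : ℝ) : ℝ :=
  Real.exp (-u) * ∑ k ∈ Finset.range m, u ^ k / k.factorial

theorem poissonBelow_nonneg (m : ℕ) {u : ℝ} (hu : 0 ≤ u) : 0 ≤ poissonBelow m u := by
  unfold poissonBelow
  positivity

open scoped NNReal in
theorem poissonMeasure_real_Ici (m : ℕ) (u : ℝ≥0) :
    (poissonMeasure u).real (Set.Ici m) = 1 - poissonBelow m u := by
  have h : (poissonMeasure u).real (Set.Iio m) = poissonBelow m u := by
    have : (Set.Iio m) = ((Finset.range m : Finset ℕ) : Set ℕ) := by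
      ext
      simp
    rw [this, ← sum_measureReal_singleton, poissonBelow, Finset.mul_sum]
    exact Finset.sum_congr rfl fun k _ => by rw [poissonMeasure_real_singleton, mul_div_assoc]
  rw [← h, ← Set.compl_Iio, probReal_compl_eq_one_sub measurableSet_Iio]

/-- The derivative telescopes to its top term; its sign gives the monotonicity used in the
domination and in the sum–integral comparison. -/
theorem hasDerivAt_poissonBelow (m : ℕ) (u : ℝ) :
    HasDerivAt (poissonBelow (m + 1)) (-(Real.exp (-u) * (u ^ m / m.factorial))) u := by
  have hexp : HasDerivAt (fun u : ℝ => Real.exp (-u)) (-Real.exp (-u)) u := by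
    simpa using (hasDerivAt_neg u).exp
  induction m with
  | zero =>
    have : poissonBelow (0 + 1) = fun u => Real.exp (-u) := by
      ext
      simp [poissonBelow]
    rw [this]
    simpa using hexp
  | succ m ih =>
    have : poissonBelow (m + 1 + 1)
        = fun u => poissonBelow (m + 1) u + Real.exp (-u) * (u ^ (m + 1) / (m + 1).factorial) := by
      ext
      simp only [poissonBelow]
      rw [Finset.sum_range_succ _ (m + 1), mul_add]
    rw [this]
    refine (ih.add (hexp.mul ((hasDerivAt_pow (m + 1) u).div_const _))).congr_deriv ?_
    rw [Nat.factorial_succ]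
    have := Nat.factorial_ne_zero m
    push_cast
    field_simp
    simp

theorem continuous_poissonBelow (m : ℕ) : Continuous (poissonBelow m) := by
  unfold poissonBelow
  fun_prop

theorem antitoneOn_poissonBelow (m : ℕ) : AntitoneOn (poissonBelow m) (Set.Ici 0) := by
  rcases m with _ | m
  · intro a _ b _ _
    simp [poissonBelow]
  refine antitoneOn_of_deriv_nonpos (convex_Ici 0) (continuous_poissonBelow _).continuousOn
    (fun u _ => (hasDerivAt_poissonBelow m u).differentiableAt.differentiableWithinAt) ?_
  intro u hu
  rw [interior_Ici] at hu
  have : 0 < u := hu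
  rw [(hasDerivAt_poissonBelow m u).deriv, neg_nonpos]
  positivity

/-- Half of the exponential decay is spent on absorbing the polynomial: `(u/2)^k / k! ≤ exp (u/2)`.
-/
theorem poissonBelow_le (m : ℕ) {u : ℝ} (hu : 0 ≤ u) :
    poissonBelow m u ≤ (∑ k ∈ Finset.range m, (2 : ℝ) ^ k) * Real.exp (-(u / 2)) := by
  unfold poissonBelow
  rw [Finset.mul_sum, Finset.sum_mul]
  refine Finset.sum_le_sum fun k _ => ?_
  have h := Real.pow_div_factorial_le_exp (x := u / 2) (by positivity) k
  have e : u ^ k / (k.factorial : ℝ) = 2 ^ k * ((u / 2) ^ k / k.factorial) := by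
    rw [div_pow]
    field_simp
  have e2 : Real.exp (-(u / 2)) = Real.exp (-u) * Real.exp (u / 2) := by
    rw [← Real.exp_add]
    congr 1
    ring
  rw [e, e2]
  calc Real.exp (-u) * (2 ^ k * ((u / 2) ^ k / k.factorial))
      ≤ Real.exp (-u) * (2 ^ k * Real.exp (u / 2)) := by gcongr
    _ = _ := by ring

theorem tendsto_poissonBelow_atTop (m : ℕ) : Tendsto (poissonBelow m) atTop (𝓝 0) := by
  have h : Tendsto (fun u : ℝ => (∑ k ∈ Finset.range m, (2 : ℝ) ^ k) * Real.exp (-(u / 2)))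
      atTop (𝓝 ((∑ k ∈ Finset.range m, (2 : ℝ) ^ k) * 0)) :=
    (Real.tendsto_exp_neg_atTop_nhds_zero.comp
      (tendsto_id.atTop_div_const (by norm_num : (0 : ℝ) < 2))).const_mul _
  rw [mul_zero] at h
  refine squeeze_zero' ?_ ?_ h
  · filter_upwards [eventually_ge_atTop 0] with u hu using poissonBelow_nonneg m hu
  · filter_upwards [eventually_ge_atTop 0] with u hu using poissonBelow_le m hu

/-! ### Rescaling near the rarest type -/

theorem one_add_mul_le_one_sub_rpow_neg {α y : ℝ} (hα : 0 < α) (hy : y < 1) :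
    1 + α * y ≤ (1 - y) ^ (-α) := by
  have h0 : 0 < 1 - y := by linarith
  rw [Real.rpow_def_of_pos h0]
  have h1 := Real.log_le_sub_one_of_pos h0
  have h2 := Real.add_one_le_exp (Real.log (1 - y) * -α)
  nlinarith

/-- This is the derivative of `h ↦ (1 - w h)^(-α)` at `0`, read along `h = 1/t`. -/
theorem tendsto_mul_one_sub_rpow_neg_sub (α w : ℝ) :
    Tendsto (fun t : ℝ => t * (1 - w / t) ^ (-α) - t) atTop (𝓝 (α * w)) := by
  have hd : HasDerivAt (fun h : ℝ => (1 - w * h) ^ (-α)) (α * w) 0 := by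
    have h1 : HasDerivAt (fun h : ℝ => 1 - w * h) (-w) 0 := by
      simpa using ((hasDerivAt_id (0 : ℝ)).const_mul w).const_sub 1
    have := h1.rpow_const (p := -α) (Or.inl (by simp))
    simpa [mul_comm] using this
  have h := hd.tendsto_slope_zero_right.comp tendsto_inv_atTop_nhdsGT_zero
  refine h.congr' ?_
  filter_upwards [eventually_gt_atTop 0] with t ht
  simp only [Function.comp_apply, inv_inv, zero_add, smul_eq_mul, mul_zero, sub_zero,
    Real.one_rpow, div_eq_mul_inv]
  ring

/-- `exp t * t⁻ᴹ * P(Poi(u t) ≤ M) → exp (-b) / M!` when `u t - t → b`. -/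
theorem tendsto_exp_mul_poissonBelow (M : ℕ) {u : ℝ → ℝ} {b : ℝ}
    (hu : Tendsto (fun t => u t - t) atTop (𝓝 b)) :
    Tendsto (fun t => Real.exp t / t ^ M * poissonBelow (M + 1) (u t)) atTop
      (𝓝 (Real.exp (-b) / M.factorial)) := by
  have hratio : Tendsto (fun t => u t / t) atTop (𝓝 1) := by
    have : Tendsto (fun t => (u t - t) * t⁻¹ + 1) atTop (𝓝 (b * 0 + 1)) :=
      (hu.mul tendsto_inv_atTop_zero).add_const 1
    rw [mul_zero, zero_add] at this
    refine this.congr' ?_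
    filter_upwards [eventually_gt_atTop 0] with t ht
    field_simp
    ring
  -- After division by `t ^ M` only the top term of the truncated exponential series survives.
  have hterm : Tendsto (fun t => ∑ k ∈ Finset.range M, (u t / t) ^ k * (t⁻¹) ^ (M - k)
      / k.factorial + (u t / t) ^ M / M.factorial) atTop (𝓝 (1 / M.factorial)) := by
    have h1 : Tendsto (fun t => ∑ k ∈ Finset.range M, (u t / t) ^ k * (t⁻¹) ^ (M - k)
      / k.factorial) atTop (𝓝 (∑ k ∈ Finset.range M, 0)) := by
      refine tendsto_finsetSum _ fun k hk => ?_
      have h0 : M - k ≠ 0 := by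
        have := Finset.mem_range.1 hk
        omega
      have := ((hratio.pow k).mul ((tendsto_inv_atTop_zero (𝕜 := ℝ)).pow (M - k))).div_const
        (k.factorial : ℝ)
      simpa [h0] using this
    have h2 := h1.add ((hratio.pow M).div_const (M.factorial : ℝ))
    simpa using h2
  have hmain : Tendsto (fun t => Real.exp (-(u t - t)) * (∑ k ∈ Finset.range M, (u t / t) ^ k *
      (t⁻¹) ^ (M - k) / k.factorial + (u t / t) ^ M / M.factorial)) atTop
      (𝓝 (Real.exp (-b) * (1 / M.factorial))) :=
    ((Real.continuous_exp.tendsto _).comp hu.neg).mul hterm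
  rw [mul_one_div] at hmain
  refine hmain.congr' ?_
  filter_upwards [eventually_gt_atTop 0] with t ht
  have e : Real.exp (-(u t - t)) = Real.exp t * Real.exp (-u t) := by
    rw [← Real.exp_add]
    congr 1
    ring
  rw [e, poissonBelow, Finset.sum_range_succ, div_eq_mul_inv (Real.exp t), mul_assoc, mul_assoc,
    mul_left_comm (t ^ M)⁻¹]
  congr 2
  rw [mul_add, Finset.mul_sum]
  congr 1
  · refine Finset.sum_congr rfl fun k hk => ?_
    have hk' : M = k + (M - k) := by
      have := Finset.mem_range.1 hk
      omega
    nth_rewrite 2 [hk']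
    rw [pow_add, div_pow, inv_pow]
    field_simp
  · rw [div_pow]
    field_simp

/-- The integrand of the rescaled sum of the probabilities that a type is still incomplete. -/
noncomputable def scaledBelow (M : ℕ) (α t w : ℝ) : ℝ :=
  Real.exp t / t ^ M * poissonBelow (M + 1) (t * (1 - w / t) ^ (-α))

/-- The integrable majorant for dominated convergence. Monotonicity replaces the mean by `t + α w`;
for `t ≥ 1`, `t + α w ≤ t (1 + α w)` bounds the expression by its value at `t = 1`, where
`poissonBelow_le` applies. -/
theorem exists_scaledBelow_le (M : ℕ) {α : ℝ} (hα : 0 < α) :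
    ∃ K : ℝ, ∀ t w : ℝ, 1 ≤ t → 0 ≤ w → w < t →
      scaledBelow M α t w ≤ K * Real.exp (-(α / 2) * w) := by
  refine ⟨Real.exp 1 * ((∑ k ∈ Finset.range (M + 1), (2 : ℝ) ^ k) * Real.exp (-(1 / 2))),
    fun t w ht hw hwt => ?_⟩
  have ht0 : 0 < t := by linarith
  have hy : w / t < 1 := (div_lt_one ht0).2 hwt
  have h1 : t + α * w ≤ t * (1 - w / t) ^ (-α) := by
    have := mul_le_mul_of_nonneg_left (one_add_mul_le_one_sub_rpow_neg hα hy) ht0.le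
    calc t + α * w = t * (1 + α * (w / t)) := by field_simp
      _ ≤ _ := this
  have hle : poissonBelow (M + 1) (t * (1 - w / t) ^ (-α)) ≤ poissonBelow (M + 1) (t + α * w) := by
    have h0 : 0 ≤ t + α * w := by positivity
    exact antitoneOn_poissonBelow _ (Set.mem_Ici.2 h0) (Set.mem_Ici.2 (h0.trans h1)) h1
  have h2 : Real.exp t / t ^ M * poissonBelow (M + 1) (t + α * w)
      ≤ Real.exp 1 * poissonBelow (M + 1) (1 + α * w) := by
    unfold poissonBelow
    have e1 : Real.exp (-(t + α * w)) = Real.exp (-t) * Real.exp (-(α * w)) := by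
      rw [← Real.exp_add]
      congr 1
      ring
    have e2 : Real.exp (-(1 + α * w)) = Real.exp (-1) * Real.exp (-(α * w)) := by
      rw [← Real.exp_add]
      congr 1
      ring
    have e3 : ∑ k ∈ Finset.range (M + 1), (t + α * w) ^ k / k.factorial
        ≤ t ^ M * ∑ k ∈ Finset.range (M + 1), (1 + α * w) ^ k / k.factorial := by
      rw [Finset.mul_sum]
      refine Finset.sum_le_sum fun k hk => ?_
      rw [← mul_div_assoc]
      gcongr
      have hk' : k ≤ M := Nat.lt_succ_iff.1 (Finset.mem_range.1 hk)
      calc (t + α * w) ^ k ≤ (t * (1 + α * w)) ^ k := by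
            gcongr
            nlinarith [mul_nonneg hα.le hw]
        _ = t ^ k * (1 + α * w) ^ k := mul_pow _ _ _
        _ ≤ t ^ M * (1 + α * w) ^ k := by
            gcongr
    rw [e1, e2, Real.exp_neg t, Real.exp_neg 1]
    calc Real.exp t / t ^ M * ((Real.exp t)⁻¹ * Real.exp (-(α * w))
          * ∑ k ∈ Finset.range (M + 1), (t + α * w) ^ k / k.factorial)
        ≤ Real.exp t / t ^ M * ((Real.exp t)⁻¹ * Real.exp (-(α * w))
          * (t ^ M * ∑ k ∈ Finset.range (M + 1), (1 + α * w) ^ k / k.factorial)) := by gcongr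
      _ = _ := by
        have := Real.exp_ne_zero t
        have := Real.exp_ne_zero 1
        field_simp
  calc scaledBelow M α t w ≤ Real.exp t / t ^ M * poissonBelow (M + 1) (t + α * w) := by
        unfold scaledBelow
        gcongr
    _ ≤ Real.exp 1 * poissonBelow (M + 1) (1 + α * w) := h2
    _ ≤ Real.exp 1 * ((∑ k ∈ Finset.range (M + 1), (2 : ℝ) ^ k)
          * Real.exp (-((1 + α * w) / 2))) := by
        gcongr
        exact poissonBelow_le _ (by positivity)
    _ = _ := by
        rw [mul_assoc, mul_assoc, ← Real.exp_add]
        congr 3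
        ring

theorem tendsto_integral_scaledBelow (M : ℕ) {α : ℝ} (hα : 0 < α) {T : ℕ → ℝ}
    (hT : Tendsto T atTop atTop) :
    Tendsto (fun N : ℕ => ∫ w in (0 : ℝ)..(T N * (1 - 1 / N)), scaledBelow M α (T N) w) atTop
      (𝓝 (1 / (α * M.factorial))) := by
  obtain ⟨K, hK⟩ := exists_scaledBelow_le M hα
  have hev : ∀ᶠ N : ℕ in atTop, 1 ≤ T N ∧ 1 ≤ N :=
    (hT.eventually_ge_atTop 1).and (eventually_ge_atTop 1)
  have hlim : ∫ w in Set.Ioi (0 : ℝ), Real.exp (-(α * w)) / M.factorial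
      = 1 / (α * M.factorial) := by
    rw [integral_div]
    have := integral_exp_mul_Ioi (a := -α) (by linarith) 0
    simp only [neg_mul, mul_zero, Real.exp_zero] at this
    rw [this]
    field_simp
  rw [← hlim]
  have hdct : Tendsto (fun N : ℕ => ∫ w in Set.Ioi (0 : ℝ),
      (Set.Ioc 0 (T N * (1 - 1 / N))).indicator (scaledBelow M α (T N)) w) atTop
      (𝓝 (∫ w in Set.Ioi (0 : ℝ), Real.exp (-(α * w)) / M.factorial)) := by
    refine tendsto_integral_filter_of_dominated_convergence
      (fun w => K * Real.exp (-(α / 2) * w)) ?_ ?_ ?_ ?_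
    · refine Eventually.of_forall fun N => Measurable.aestronglyMeasurable ?_
      refine Measurable.indicator ?_ measurableSet_Ioc
      unfold scaledBelow
      have := (continuous_poissonBelow (M + 1)).measurable
      fun_prop
    · filter_upwards [hev] with N hN
      refine (ae_restrict_mem measurableSet_Ioi).mono fun w hw => ?_
      have hw0 : 0 < w := hw
      have hN' : (0 : ℝ) < 1 / N := by
        have : (1 : ℝ) ≤ N := by exact_mod_cast hN.2
        positivity
      by_cases hmem : w ∈ Set.Ioc 0 (T N * (1 - 1 / N))
      · rw [Set.indicator_of_mem hmem]
        have hwT : w < T N := by nlinarith [hmem.2, hN.1]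
        have hT0 : 0 < T N := by linarith [hN.1]
        have : 0 ≤ 1 - w / T N := by
          rw [sub_nonneg, div_le_one hT0]
          exact hwT.le
        have h0 : 0 ≤ scaledBelow M α (T N) w :=
          mul_nonneg (by positivity) (poissonBelow_nonneg _ (by positivity))
        rw [Real.norm_of_nonneg h0]
        exact hK _ _ hN.1 hw0.le hwT
      · rw [Set.indicator_of_notMem hmem, norm_zero]
        -- Outside the interval only nonnegativity of the majorant is needed; the bound at the
        -- admissible value `t = w + 1` supplies it.
        have := hK (w + 1) w (by linarith) hw0.le (by linarith)
        have h1 : 0 ≤ scaledBelow M α (w + 1) w := by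
          have : 0 ≤ 1 - w / (w + 1) := by
            rw [sub_nonneg, div_le_one (by positivity)]
            linarith
          exact mul_nonneg (by positivity) (poissonBelow_nonneg _ (by positivity))
        linarith
    · exact (integrableOn_exp_mul_Ioi (by linarith) 0).const_mul K
    · refine (ae_restrict_mem measurableSet_Ioi).mono fun w hw => ?_
      have hw0 : 0 < w := hw
      have h1 := (tendsto_exp_mul_poissonBelow M (tendsto_mul_one_sub_rpow_neg_sub α w)).comp hT
      refine h1.congr' ?_
      have hc : Tendsto (fun N : ℕ => (1 - 1 / (N : ℝ))) atTop (𝓝 (1 - 0)) :=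
        tendsto_one_div_atTop_nhds_zero_nat.const_sub 1
      rw [sub_zero] at hc
      filter_upwards [(hT.atTop_mul_pos one_pos hc).eventually_ge_atTop w] with N hN
      rw [Set.indicator_of_mem (Set.mem_Ioc.2 ⟨hw0, hN⟩)]
      rfl
  refine hdct.congr' ?_
  filter_upwards [hev] with N hN
  have : 0 ≤ T N * (1 - 1 / (N : ℝ)) := by
    have h1 : (1 : ℝ) / N ≤ 1 := by
      rw [div_le_one (by exact_mod_cast hN.2)]
      exact_mod_cast hN.2
    have := hN.1
    exact mul_nonneg (by linarith) (by linarith)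
  rw [intervalIntegral.integral_of_le this, setIntegral_indicator measurableSet_Ioc,
    Set.inter_eq_right.2 Set.Ioc_subset_Ioi_self]

/-- Substitution `y/N = 1 - w/t`: it magnifies the neighbourhood of `y = N` at scale `N/t`. -/
theorem integral_poissonBelow_rpow (M : ℕ) (α : ℝ) {t : ℝ} (ht : 0 < t) {N : ℕ} (hN : 1 ≤ N) :
    ∫ y in (1 : ℝ)..N, poissonBelow (M + 1) (t * (y / N) ^ (-α))
      = N / t * ∫ w in (0 : ℝ)..(t * (1 - 1 / N)),
          poissonBelow (M + 1) (t * (1 - w / t) ^ (-α)) := by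
  have hN0 : (N : ℝ) ≠ 0 := by
    have : N ≠ 0 := by omega
    exact_mod_cast this
  rw [intervalIntegral.integral_comp_sub_div (fun v => poissonBelow (M + 1) (t * v ^ (-α))) ht.ne' 1,
    intervalIntegral.integral_comp_div (fun v => poissonBelow (M + 1) (t * v ^ (-α))) hN0,
    smul_eq_mul, smul_eq_mul, ← mul_assoc, div_mul_cancel₀ _ ht.ne', mul_div_cancel_left₀ _ ht.ne',
    div_self hN0]
  simp

/-- The summand increases with the index, so sum and integral differ by at most the last term, that
of the rarest type. -/
theorem sum_poissonBelow_rpow_bounds (M : ℕ) {α : ℝ} (hα : 0 < α) {t : ℝ} (ht : 0 < t) {N : ℕ}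
    (hN : 1 ≤ N) :
    (∫ y in (1 : ℝ)..N, poissonBelow (M + 1) (t * (y / N) ^ (-α)))
        ≤ ∑ i ∈ Finset.range N, poissonBelow (M + 1) (t * (((i + 1 : ℕ) : ℝ) / N) ^ (-α)) ∧
      ∑ i ∈ Finset.range N, poissonBelow (M + 1) (t * (((i + 1 : ℕ) : ℝ) / N) ^ (-α))
        ≤ (∫ y in (1 : ℝ)..N, poissonBelow (M + 1) (t * (y / N) ^ (-α)))
          + poissonBelow (M + 1) t := by
  set f : ℝ → ℝ := fun y => poissonBelow (M + 1) (t * (y / N) ^ (-α)) with hf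
  have hN0 : (0 : ℝ) < N := by exact_mod_cast hN
  have hpos : ∀ y : ℝ, 0 ≤ y → 0 ≤ t * (y / N) ^ (-α) := fun y hy => by positivity
  have hmono : MonotoneOn f (Set.Icc ((1 : ℕ) : ℝ) N) := by
    intro a ha b hb hab
    have ha1 : 1 ≤ a := by simpa using ha.1
    refine antitoneOn_poissonBelow _ (hpos b (by linarith)) (hpos a (by linarith)) ?_
    refine mul_le_mul_of_nonneg_left ?_ ht.le
    exact Real.rpow_le_rpow_of_nonpos (by positivity) (by gcongr) (by linarith)
  have h1 := hmono.integral_le_sum_Ico hN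
  have h2 := hmono.sum_le_integral_Ico hN
  rw [Nat.cast_one] at h1 h2
  have hfN : f N = poissonBelow (M + 1) t := by simp [hf, hN0.ne']
  have hf1 : 0 ≤ f ((0 + 1 : ℕ) : ℝ) := poissonBelow_nonneg _ (hpos _ (by positivity))
  have e1 : ∑ i ∈ Finset.range N, f ((i + 1 : ℕ) : ℝ)
      = f ((0 + 1 : ℕ) : ℝ) + ∑ i ∈ Finset.Ico 1 N, f ((i + 1 : ℕ) : ℝ) := by
    rw [Finset.range_eq_Ico, Finset.sum_eq_sum_Ico_succ_bot (by omega)]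
  have e2 : ∑ i ∈ Finset.range N, f ((i + 1 : ℕ) : ℝ) = ∑ i ∈ Finset.Ico 1 N, f (i : ℝ) + f N := by
    rw [← Finset.sum_Ico_succ_top hN, Finset.sum_Ico_eq_sum_range]
    simp [add_comm]
  refine ⟨?_, ?_⟩
  · change _ ≤ ∑ i ∈ Finset.range N, f ((i + 1 : ℕ) : ℝ)
    linarith
  · change ∑ i ∈ Finset.range N, f ((i + 1 : ℕ) : ℝ) ≤ _
    linarith

/-- Sharp asymptotics of the expected number of types drawn fewer than `M + 1` times. -/
theorem tendsto_sum_poissonBelow_rpow (M : ℕ) {α : ℝ} (hα : 0 < α) {T : ℕ → ℝ}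
    (hT : Tendsto T atTop atTop) {L : ℝ}
    (hL : Tendsto (fun N : ℕ => N * (T N ^ M / T N) * Real.exp (-T N)) atTop
      (𝓝 (α * M.factorial * L))) :
    Tendsto (fun N : ℕ => ∑ i ∈ Finset.range N,
      poissonBelow (M + 1) (T N * (((i + 1 : ℕ) : ℝ) / N) ^ (-α))) atTop (𝓝 L) := by
  have hI : Tendsto (fun N : ℕ => ∫ y in (1 : ℝ)..N,
      poissonBelow (M + 1) (T N * (y / N) ^ (-α))) atTop (𝓝 L) := by
    -- The prefactor in `hL` combines the Jacobian `N/t` with the inverse of the normalization `exp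
    -- t / t ^ M`.
    have h := hL.mul (tendsto_integral_scaledBelow M hα hT)
    have hM : (M.factorial : ℝ) ≠ 0 := by exact_mod_cast M.factorial_ne_zero
    have e : α * M.factorial * L * (1 / (α * M.factorial)) = L := by field_simp
    rw [e] at h
    refine h.congr' ?_
    filter_upwards [hT.eventually_gt_atTop 0, eventually_ge_atTop 1] with N h0 hN
    rw [integral_poissonBelow_rpow M α h0 hN]
    simp only [scaledBelow]
    rw [intervalIntegral.integral_const_mul, Real.exp_neg]
    have := Real.exp_ne_zero (T N)
    field_simp
  have hE := (tendsto_poissonBelow_atTop (M + 1)).comp hT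
  have hI2 := hI.add hE
  rw [add_zero] at hI2
  refine tendsto_of_tendsto_of_tendsto_of_le_of_le' hI hI2 ?_ ?_
  · filter_upwards [hT.eventually_gt_atTop 0, eventually_ge_atTop 1] with N h0 hN
      using (sum_poissonBelow_rpow_bounds M hα h0 hN).1
  · filter_upwards [hT.eventually_gt_atTop 0, eventually_ge_atTop 1] with N h0 hN
      using (sum_poissonBelow_rpow_bounds M hα h0 hN).2

/-! ### Limit of the product of completion probabilities -/

/-- Poisson approximation of a product of uniformly small failure probabilities. -/
theorem tendsto_prod_one_sub {q : ℕ → ℕ → ℝ} {δ : ℕ → ℝ} {L : ℝ}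
    (hq0 : ∀ᶠ N in atTop, ∀ i < N, 0 ≤ q N i) (hqδ : ∀ᶠ N in atTop, ∀ i < N, q N i ≤ δ N)
    (hδ : Tendsto δ atTop (𝓝 0))
    (hL : Tendsto (fun N => ∑ i ∈ Finset.range N, q N i) atTop (𝓝 L)) :
    Tendsto (fun N => ∏ i ∈ Finset.range N, (1 - q N i)) atTop (𝓝 (Real.exp (-L))) := by
  have hup : Tendsto (fun N => Real.exp (-∑ i ∈ Finset.range N, q N i)) atTop
      (𝓝 (Real.exp (-L))) := (Real.continuous_exp.tendsto _).comp hL.neg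
  have hlow : Tendsto (fun N => Real.exp (-((∑ i ∈ Finset.range N, q N i) / (1 - δ N)))) atTop
      (𝓝 (Real.exp (-(L / (1 - 0))))) :=
    (Real.continuous_exp.tendsto _).comp (hL.div (hδ.const_sub 1) (by norm_num)).neg
  rw [sub_zero, div_one] at hlow
  refine tendsto_of_tendsto_of_tendsto_of_le_of_le' hlow hup ?_ ?_
  · filter_upwards [hq0, hqδ, hδ.eventually_lt_const one_pos] with N h0 h1 h2
    rw [Finset.sum_div, ← Finset.sum_neg_distrib, Real.exp_sum]
    refine Finset.prod_le_prod (fun _ _ => (Real.exp_pos _).le) fun i hi => ?_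
    have hi' := Finset.mem_range.1 hi
    have hq := h0 i hi'
    have hqd := h1 i hi'
    have hpos : 0 < 1 - q N i := by linarith
    -- The bound `exp (-q/(1-q)) ≤ 1 - q` is `1 + z ≤ exp z` at `z = q/(1-q)`.
    calc Real.exp (-(q N i / (1 - δ N))) ≤ Real.exp (-(q N i / (1 - q N i))) := by
          gcongr
      _ = (Real.exp (q N i / (1 - q N i)))⁻¹ := Real.exp_neg _
      _ ≤ ((1 - q N i)⁻¹)⁻¹ := by
          refine inv_anti₀ (inv_pos.2 hpos) ?_
          have := Real.add_one_le_exp (q N i / (1 - q N i))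
          have e : (1 - q N i)⁻¹ = q N i / (1 - q N i) + 1 := by
            field_simp
            ring
          rwa [e]
      _ = 1 - q N i := inv_inv _
  · filter_upwards [hq0, hqδ, hδ.eventually_lt_const one_pos] with N h0 h1 h2
    rw [← Finset.sum_neg_distrib, Real.exp_sum]
    refine Finset.prod_le_prod (fun i hi => ?_) fun i _ => Real.one_sub_le_exp_neg _
    have := h1 i (Finset.mem_range.1 hi)
    linarith

theorem tendsto_prod_one_sub_poissonBelow_rpow (M : ℕ) {α : ℝ} (hα : 0 < α) {T : ℕ → ℝ}
    (hT : Tendsto T atTop atTop) {L : ℝ}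
    (hL : Tendsto (fun N : ℕ => N * (T N ^ M / T N) * Real.exp (-T N)) atTop
      (𝓝 (α * M.factorial * L))) :
    Tendsto (fun N : ℕ => ∏ i ∈ Finset.range N,
      (1 - poissonBelow (M + 1) (T N * (((i + 1 : ℕ) : ℝ) / N) ^ (-α)))) atTop
      (𝓝 (Real.exp (-L))) := by
  refine tendsto_prod_one_sub (δ := fun N => poissonBelow (M + 1) (T N)) ?_ ?_
    ((tendsto_poissonBelow_atTop _).comp hT) (tendsto_sum_poissonBelow_rpow M hα hT hL)
  · filter_upwards [hT.eventually_gt_atTop 0] with N h0 i _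
    exact poissonBelow_nonneg _ (by positivity)
  · filter_upwards [hT.eventually_gt_atTop 0] with N h0 i hi
    have h1 : T N ≤ T N * (((i + 1 : ℕ) : ℝ) / N) ^ (-α) := by
      refine le_mul_of_one_le_right h0.le ?_
      have hN : (0 : ℝ) < N := by
        have : 0 < N := by omega
        exact_mod_cast this
      refine Real.one_le_rpow_of_pos_of_le_one_of_nonpos (by positivity) ?_ (by linarith)
      rw [div_le_one hN]
      exact_mod_cast hi
    exact antitoneOn_poissonBelow _ h0.le (h0.le.trans h1) h1

/-! ### The centring -/

/-- `(B_N + x C_N) / C_N`: the rescaled Poisson time. -/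
noncomputable def powerLawTime (M : ℕ) (α x : ℝ) (N : ℕ) : ℝ :=
  powerLawRho α N + ((M : ℝ) - 1) * Real.log (powerLawRho α N)
    - Real.log (M.factorial : ℝ) + x

theorem tendsto_powerLawRho {α : ℝ} (hα : 0 < α) : Tendsto (powerLawRho α) atTop atTop :=
  Real.tendsto_log_atTop.comp (tendsto_natCast_atTop_atTop.atTop_div_const hα)

theorem tendsto_powerLawTime_div_rho (M : ℕ) {α : ℝ} (hα : 0 < α) (x : ℝ) :
    Tendsto (fun N => powerLawTime M α x N / powerLawRho α N) atTop (𝓝 1) := by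
  have h : Tendsto (fun r : ℝ => 1 + ((M : ℝ) - 1) * (Real.log r / r)
      + (x - Real.log (M.factorial : ℝ)) * r⁻¹) atTop
      (𝓝 (1 + ((M : ℝ) - 1) * 0 + (x - Real.log (M.factorial : ℝ)) * 0)) :=
    ((Real.isLittleO_log_id_atTop.tendsto_div_nhds_zero.const_mul _).const_add 1).add
      (tendsto_inv_atTop_zero.const_mul _)
  simp only [mul_zero, add_zero] at h
  refine (h.comp (tendsto_powerLawRho hα)).congr' ?_
  filter_upwards [(tendsto_powerLawRho hα).eventually_gt_atTop 0] with N hN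
  simp only [Function.comp_apply, powerLawTime]
  field_simp
  ring

theorem tendsto_powerLawTime (M : ℕ) {α : ℝ} (hα : 0 < α) (x : ℝ) :
    Tendsto (powerLawTime M α x) atTop atTop := by
  refine ((tendsto_powerLawRho hα).atTop_mul_pos one_pos
    (tendsto_powerLawTime_div_rho M hα x)).congr' ?_
  filter_upwards [(tendsto_powerLawRho hα).eventually_gt_atTop 0] with N hN
  field_simp

theorem tendsto_powerLawTime_div (M : ℕ) {α : ℝ} (hα : 0 < α) (x : ℝ) :
    Tendsto (fun N => powerLawTime M α x N / N) atTop (𝓝 0) := by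
  have h1 : Tendsto (fun N : ℕ => powerLawRho α N / N) atTop (𝓝 0) := by
    have := (Real.isLittleO_log_id_atTop.tendsto_div_nhds_zero.comp
      (tendsto_natCast_atTop_atTop (R := ℝ) |>.atTop_div_const hα)).mul_const (1 / α)
    rw [zero_mul] at this
    refine this.congr' ?_
    filter_upwards [eventually_gt_atTop 0] with N hN
    simp only [Function.comp_apply, powerLawRho, id]
    field_simp
  have h2 := (tendsto_powerLawTime_div_rho M hα x).mul h1
  rw [mul_zero] at h2
  refine h2.congr' ?_
  filter_upwards [(tendsto_powerLawRho hα).eventually_gt_atTop 0] with N hN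
  field_simp

/-- With `ρ = powerLawRho α N` and `T = powerLawTime M α x N`, `exp (-T) = (α/N) ρ^(1-M) M! exp
(-x)` exactly, so the expression is its limit times a power of `T/ρ`, and `T/ρ → 1`. -/
theorem tendsto_powerLawTime_exp (M : ℕ) {α : ℝ} (hα : 0 < α) (x : ℝ) :
    Tendsto (fun N : ℕ => N * (powerLawTime M α x N ^ M / powerLawTime M α x N)
      * Real.exp (-powerLawTime M α x N)) atTop (𝓝 (α * M.factorial * Real.exp (-x))) := by
  have h := tendsto_powerLawTime_div_rho M hα x
  have h2 := ((h.pow M).div h one_ne_zero).const_mul (α * M.factorial * Real.exp (-x))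
  rw [one_pow, div_one, mul_one] at h2
  refine h2.congr' ?_
  filter_upwards [(tendsto_powerLawRho hα).eventually_gt_atTop 0,
    (tendsto_powerLawTime M hα x).eventually_gt_atTop 0, eventually_gt_atTop 0] with N hr ht hN
  have hN' : (0 : ℝ) < N := by exact_mod_cast hN
  have e : Real.exp (-powerLawTime M α x N)
      = α / N * (powerLawRho α N / powerLawRho α N ^ M) * M.factorial * Real.exp (-x) := by
    have e1 : -powerLawTime M α x N = -powerLawRho α N + Real.log (powerLawRho α N)
        + -(M * Real.log (powerLawRho α N)) + Real.log (M.factorial : ℝ) + -x := by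
      unfold powerLawTime
      ring
    rw [e1, Real.exp_add, Real.exp_add, Real.exp_add, Real.exp_add, Real.exp_log hr,
      Real.exp_log (by positivity), Real.exp_neg (M * _), Real.exp_nat_mul, Real.exp_log hr,
      Real.exp_neg (powerLawRho α N)]
    nth_rewrite 1 [powerLawRho]
    rw [Real.exp_log (by positivity), inv_div]
    ring
  simp only [Pi.div_apply]
  rw [e, div_pow]
  field_simp

theorem tendsto_prod_powerLawTime (M : ℕ) {α : ℝ} (hα : 0 < α) (x : ℝ) :
    Tendsto (fun N : ℕ => ∏ i ∈ Finset.range N,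
      (1 - poissonBelow (M + 1) (powerLawTime M α x N * (((i + 1 : ℕ) : ℝ) / N) ^ (-α)))) atTop
      (𝓝 (Real.exp (-Real.exp (-x)))) :=
  tendsto_prod_one_sub_poissonBelow_rpow M hα (tendsto_powerLawTime M hα x)
    (tendsto_powerLawTime_exp M hα x)

/-! ### Weak convergence from distribution functions -/

/-- Convergence of distribution functions everywhere implies weak convergence. -/
theorem tendsto_probabilityMeasure_of_tendsto_Iic {κ : Type*} {l : Filter κ}
    [l.IsCountablyGenerated] {μ : κ → ProbabilityMeasure ℝ} {ν : ProbabilityMeasure ℝ}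
    (h : ∀ x, Tendsto (fun i => (μ i : Measure ℝ).real (Set.Iic x)) l
      (𝓝 ((ν : Measure ℝ).real (Set.Iic x)))) : Tendsto μ l (𝓝 ν) := by
  refine (isPiSystem_Ioc (id : ℝ → ℝ) id).tendsto_probabilityMeasure_of_tendsto_of_mem ?_ ?_ ?_
  · rintro s ⟨a, b, -, rfl⟩
    exact measurableSet_Ioc
  · intro u hu x hx
    obtain ⟨ε, hε, hball⟩ := Metric.isOpen_iff.1 hu x hx
    refine ⟨Set.Ioc (x - ε / 2) (x + ε / 2), ⟨_, _, by simp only [id]; linarith, rfl⟩,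
      Ioc_mem_nhds (by linarith) (by linarith), fun y hy => hball ?_⟩
    rw [Metric.mem_ball, Real.dist_eq, abs_lt]
    constructor <;> linarith [hy.1, hy.2]
  · rintro s ⟨a, b, hab, rfl⟩
    have e : ∀ ρ : ProbabilityMeasure ℝ, ((ρ (Set.Ioc (id a) (id b)) : NNReal) : ℝ)
        = (ρ : Measure ℝ).real (Set.Iic b) - (ρ : Measure ℝ).real (Set.Iic a) := by
      intro ρ
      rw [← measureReal_sdiff (Set.Iic_subset_Iic.2 (show a ≤ b from le_of_lt hab))
        measurableSet_Iic]
      change (ρ : Measure ℝ).real (Set.Ioc a b) = _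
      congr 1
      ext y
      simp [and_comm]
    rw [← NNReal.tendsto_coe]
    simp_rw [e]
    exact (h b).sub (h a)

/-! ### The collection time: measurability and almost sure finiteness -/

section Collection

variable {ι : Type*} [Fintype ι] [DecidableEq ι]

theorem CollectedBy.mono {κ : Type*} [DecidableEq κ] {m : ℕ} {x : ℕ → κ} {n k : ℕ}
    (h : CollectedBy m x n) (hnk : n ≤ k) : CollectedBy m x k :=
  fun j => (h j).trans (occurrences_mono x j hnk)

theorem collectionTime_le_iff {κ : Type*} [DecidableEq κ] {m : ℕ} {x : ℕ → κ}
    (h : ∃ n, CollectedBy m x n) (n : ℕ) : collectionTime m x ≤ n ↔ CollectedBy m x n :=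
  ⟨fun hn => CollectedBy.mono (Nat.sInf_mem (s := {n | CollectedBy m x n}) h) hn,
    fun hn => Nat.sInf_le hn⟩

theorem exists_collectedBy_of_infinite (m : ℕ) {x : ℕ → ι} (h : ∀ j, {k | x k = j}.Infinite) :
    ∃ n, CollectedBy m x n := by
  choose t ht htm using fun j => (h j).exists_subset_card_eq m
  refine ⟨Finset.univ.sup (fun j => (t j).sup id + 1), fun j => ?_⟩
  rw [← htm j]
  refine Finset.card_le_card fun k hk => ?_
  rw [Finset.mem_filter, Finset.mem_range]
  refine ⟨?_, ht j hk⟩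
  have h1 : k ≤ (t j).sup id := Finset.le_sup (f := id) hk
  have h2 := Finset.le_sup (f := fun j => (t j).sup id + 1) (Finset.mem_univ j)
  exact lt_of_lt_of_le (Nat.lt_succ_of_le h1) h2

variable [MeasurableSpace ι] [MeasurableSingletonClass ι] {Ω : Type*} [MeasurableSpace Ω]
  {P : Measure Ω} {X : ℕ → Ω → ι}

theorem measurableSet_collectedBy (hX : ∀ k, Measurable (X k)) (m n : ℕ) :
    MeasurableSet {ω | CollectedBy m (fun k => X k ω) n} :=
  measurable_occurrences hX n (MeasurableSet.of_discrete (s := {c : ι → ℕ | ∀ j, m ≤ c j}))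

theorem measurable_collectionTime (hX : ∀ k, Measurable (X k)) (m : ℕ) :
    Measurable fun ω => collectionTime m (fun k => X k ω) := by
  refine measurable_of_Iic fun n => ?_
  -- The second piece is there because `sInf ∅ = 0`: sequences that never complete have time `0 ≤
  -- n`.
  have : (fun ω => collectionTime m (fun k => X k ω)) ⁻¹' Set.Iic n
      = {ω | CollectedBy m (fun k => X k ω) n}
        ∪ (⋃ k, {ω | CollectedBy m (fun k => X k ω) k})ᶜ := by
    ext ω
    simp only [Set.mem_preimage, Set.mem_Iic, Set.mem_union, Set.mem_ofPred_eq, Set.mem_compl_iff,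
      Set.mem_iUnion]
    by_cases h : ∃ k, CollectedBy m (fun k => X k ω) k
    · simp [h, collectionTime_le_iff h]
    · have he : {n | CollectedBy m (fun k => X k ω) n} = ∅ :=
        Set.eq_empty_iff_forall_notMem.2 fun k hk => h ⟨k, hk⟩
      simp [h, collectionTime, he]
  rw [this]
  exact (measurableSet_collectedBy hX m n).union
    (MeasurableSet.iUnion fun k => measurableSet_collectedBy hX m k).compl

/-- By the second Borel–Cantelli lemma each type almost surely occurs infinitely often. -/
theorem ae_exists_collectedBy [IsProbabilityMeasure P] (hX : ∀ k, Measurable (X k))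
    (hI : iIndepFun X P) {p : ι → ℝ} (hp0 : ∀ j, 0 < p j)
    (hp : ∀ k j, P.real {ω | X k ω = j} = p j) (m : ℕ) :
    ∀ᵐ ω ∂P, ∃ n, CollectedBy m (fun k => X k ω) n := by
  have h : ∀ j, ∀ᵐ ω ∂P, ∃ᶠ k in atTop, X k ω = j := by
    intro j
    have hms : ∀ k, MeasurableSet (X k ⁻¹' {j}) := fun k => hX k (measurableSet_singleton j)
    have hind : iIndepSet (fun k => X k ⁻¹' {j}) P := by
      rw [iIndepSet_iff_meas_biInter hms]
      exact fun s => hI.measure_inter_preimage_eq_mul s fun _ _ => measurableSet_singleton j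
    have hsum : ∑' k, P (X k ⁻¹' {j}) = ⊤ := by
      have : ∀ k, P (X k ⁻¹' {j}) = ENNReal.ofReal (p j) := fun k => by
        rw [← hp k j, ofReal_measureReal]
        rfl
      simp_rw [this]
      exact ENNReal.tsum_const_eq_top_of_ne_zero (by simpa using hp0 j)
    have h1 := measure_limsup_eq_one hms hind hsum
    rw [← prob_compl_eq_zero_iff (MeasurableSet.measurableSet_limsup hms)] at h1
    refine (measure_eq_zero_iff_ae_notMem.1 h1).mono fun ω hω => ?_
    rw [Set.notMem_compl_iff, mem_limsup_iff_frequently_mem] at hω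
    exact hω
  filter_upwards [ae_all_iff.2 h] with ω hω
  exact exists_collectedBy_of_infinite m fun j => Nat.frequently_atTop_iff_infinite.1 (hω j)

end Collection

/-! ### De-Poissonization for the power law -/

theorem sum_range_rpow_eq_powerLawNorm (α : ℝ) (N : ℕ) :
    ∑ i ∈ Finset.range N, ((i + 1 : ℕ) : ℝ) ^ (-α) = powerLawNorm α N := by
  rw [powerLawNorm, Finset.range_eq_Ico,
    Finset.sum_Ico_add' (fun j : ℕ => (j : ℝ) ^ (-α)) 0 N 1]
  rfl

theorem powerLawNorm_pos (α : ℝ) {N : ℕ} (hN : 1 ≤ N) : 0 < powerLawNorm α N := by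
  refine Finset.sum_pos (fun j hj => ?_) ⟨1, by simpa using hN⟩
  have : (0 : ℝ) < j := by exact_mod_cast (Finset.mem_Icc.1 hj).1
  positivity

theorem powerLawProb_pos (α : ℝ) {N : ℕ} (i : Fin N) : 0 < powerLawProb α N i := by
  have := powerLawNorm_pos α (N := N) (by have := i.2; omega)
  unfold powerLawProb
  positivity

theorem sum_powerLawProb (α : ℝ) {N : ℕ} (hN : 1 ≤ N) : ∑ i, powerLawProb α N i = 1 := by
  simp_rw [powerLawProb]
  rw [Fin.sum_univ_eq_sum_range (fun i => ((i + 1 : ℕ) : ℝ) ^ (-α) / powerLawNorm α N),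
    ← Finset.sum_div, sum_range_rpow_eq_powerLawNorm, div_self (powerLawNorm_pos α hN).ne']

/-- Each of the `N` terms `(N/j)^α` is at least one. This makes the Poisson fluctuations negligible
at scale `C_N`. -/
theorem natCast_le_powerLawScale {α : ℝ} (hα : 0 < α) (N : ℕ) : (N : ℝ) ≤ powerLawScale α N := by
  rw [powerLawScale, powerLawNorm, Finset.sum_mul]
  calc (N : ℝ) = ∑ j ∈ Finset.Icc 1 N, (1 : ℝ) := by simp
    _ ≤ _ := by
      refine Finset.sum_le_sum fun j hj => ?_
      obtain ⟨h1, h2⟩ := Finset.mem_Icc.1 hj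
      have hj0 : (0 : ℝ) < j := by exact_mod_cast h1
      rw [Real.rpow_neg hj0.le, inv_mul_eq_div, one_le_div (by positivity)]
      exact Real.rpow_le_rpow hj0.le (by exact_mod_cast h2) hα.le

theorem powerLawScale_mul_powerLawProb {α : ℝ} {N : ℕ} (i : Fin N) :
    powerLawScale α N * powerLawProb α N i = ((((i : ℕ) + 1 : ℕ) : ℝ) / N) ^ (-α) := by
  have hN : 1 ≤ N := by
    have := i.2
    omega
  have h0 : (0 : ℝ) < N := by exact_mod_cast hN
  have := (powerLawNorm_pos α hN).ne'
  rw [powerLawScale, powerLawProb, Real.div_rpow (by positivity) h0.le, Real.rpow_neg h0.le α,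
    div_inv_eq_mul]
  field_simp

/-- Bounds for the law of the number of draws by Poissonized versions, with an error that vanishes
in the limit. -/
theorem measureReal_collectedBy_bounds (M : ℕ) {α : ℝ} (hα : 0 < α) {N : ℕ} (hN : 1 ≤ N)
    {Ω : Type*} [MeasurableSpace Ω] {P : Measure Ω} [IsProbabilityMeasure P]
    {X : ℕ → Ω → Fin N} (hX : ∀ k, Measurable (X k)) (hI : iIndepFun X P)
    (hp : ∀ k i, P.real {ω | X k ω = i} = powerLawProb α N i) {t ε : ℝ} (hε : 0 < ε)
    (ht : ε ≤ t) (hNε : 1 ≤ ε / 2 * N) (n : ℕ) :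
    ((n : ℝ) ≤ powerLawScale α N * (t - ε) →
      P.real {ω | CollectedBy (M + 1) (fun k => X k ω) n}
        ≤ ∏ i ∈ Finset.range N, (1 - poissonBelow (M + 1) (t * (((i + 1 : ℕ) : ℝ) / N) ^ (-α)))
          + Real.exp (-(ε ^ 2 / 16 * (t / N)⁻¹))) ∧
    (powerLawScale α N * (t + ε) - 1 ≤ n →
      ∏ i ∈ Finset.range N, (1 - poissonBelow (M + 1) (t * (((i + 1 : ℕ) : ℝ) / N) ^ (-α)))
        ≤ P.real {ω | CollectedBy (M + 1) (fun k => X k ω) n}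
          + Real.exp (-(ε ^ 2 / 16 * (t / N)⁻¹))) := by
  have hN0 : (0 : ℝ) < N := by exact_mod_cast hN
  have hC := natCast_le_powerLawScale hα N
  set C := powerLawScale α N with hCdef
  have hC0 : 0 < C := hN0.trans_le hC
  have ht0 : 0 < t := hε.trans_le ht
  set s : NNReal := ⟨C * t, by positivity⟩ with hs
  have hscoe : (s : ℝ) = C * t := rfl
  have hs0 : 0 < s := by
    have : (0 : ℝ) < s := by rw [hscoe]; positivity
    exact_mod_cast this
  set p : Fin N → NNReal := fun i => ⟨powerLawProb α N i, (powerLawProb_pos α i).le⟩ with hpdef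
  have hp1 : ∑ i, p i = 1 := by
    have := sum_powerLawProb α hN
    rw [← NNReal.coe_inj, NNReal.coe_sum, NNReal.coe_one]
    exact this
  have hp' : ∀ k i, P.real {ω | X k ω = i} = p i := hp
  have hprod : ∏ i, (poissonMeasure (s * p i)).real (Set.Ici (M + 1))
      = ∏ i ∈ Finset.range N,
        (1 - poissonBelow (M + 1) (t * (((i + 1 : ℕ) : ℝ) / N) ^ (-α))) := by
    rw [← Fin.prod_univ_eq_prod_range
      (fun i => 1 - poissonBelow (M + 1) (t * (((i + 1 : ℕ) : ℝ) / N) ^ (-α)))]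
    refine Finset.prod_congr rfl fun i _ => ?_
    rw [poissonMeasure_real_Ici, ← powerLawScale_mul_powerLawProb, NNReal.coe_mul, hscoe,
      ← hCdef]
    congr 2
    change C * t * powerLawProb α N i = _
    ring
  -- Half of the margin `ε C` is the Chernoff deviation; in the second bound the other half, at
  -- least one by `hNε`, absorbs the loss from rounding down.
  have hd0 : 0 ≤ ε / 2 * C := by positivity
  have hds : ε / 2 * C ≤ s := by
    rw [hscoe]
    nlinarith
  have hexp : Real.exp (-((ε / 2 * C) ^ 2 / (4 * s))) ≤ Real.exp (-(ε ^ 2 / 16 * (t / N)⁻¹)) := by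
    rw [Real.exp_le_exp, neg_le_neg_iff, hscoe, inv_div]
    have e : (ε / 2 * C) ^ 2 / (4 * (C * t)) = ε ^ 2 / 16 * (C / t) := by
      field_simp
      ring
    rw [e]
    gcongr
  have hεC : 1 ≤ ε / 2 * C := hNε.trans (by gcongr)
  refine ⟨fun hn => ?_, fun hn => ?_⟩
  · have h1 := measureReal_collectedBy_le hX hI hp' hp1 (M + 1) s n
    have h2 := poissonMeasure_real_le_le (a := n) hs0 hd0 hds (by rw [hscoe]; nlinarith)
    have e : {k : ℕ | (k : ℝ) ≤ n} = Set.Iic n := by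
      ext
      simp
    rw [e] at h2
    rw [← hprod]
    linarith
  · have h1 := prod_poissonMeasure_le hX hI hp' hp1 (M + 1) s n
    have h2 := poissonMeasure_real_ge_le (a := n) hs0 hd0 hds (by rw [hscoe]; nlinarith)
    have e : {k : ℕ | (n : ℝ) ≤ k} = Set.Ici n := by
      ext
      simp
    rw [e] at h2
    rw [← hprod]
    linarith

theorem tendsto_exp_neg_powerLawTime (M : ℕ) {α : ℝ} (hα : 0 < α) (x : ℝ) {ε : ℝ} (hε : 0 < ε) :
    Tendsto (fun N : ℕ => Real.exp (-(ε ^ 2 / 16 * (powerLawTime M α x N / N)⁻¹))) atTop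
      (𝓝 0) := by
  refine Real.tendsto_exp_neg_atTop_nhds_zero.comp (Tendsto.const_mul_atTop (by positivity) ?_)
  refine Tendsto.inv_tendsto_nhdsGT_zero (tendsto_nhdsWithin_iff.2
    ⟨tendsto_powerLawTime_div M hα x, ?_⟩)
  filter_upwards [(tendsto_powerLawTime M hα x).eventually_gt_atTop 0, eventually_gt_atTop 0]
    with N h0 hN
  have : (0 : ℝ) < N := by exact_mod_cast hN
  exact div_pos h0 this

/-- Convergence of the distribution function of the number of draws. -/
theorem tendsto_measureReal_collectedBy (M : ℕ) {α : ℝ} (hα : 0 < α)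
    {Ω : ℕ+ → Type*} [∀ N, MeasurableSpace (Ω N)]
    {P : ∀ N, Measure (Ω N)} [∀ N, IsProbabilityMeasure (P N)]
    {X : ∀ N : ℕ+, ℕ → Ω N → Fin N} (hX : ∀ N k, Measurable (X N k))
    (hI : ∀ N, iIndepFun (X N) (P N))
    (hp : ∀ (N : ℕ+) (k : ℕ) (i : Fin N), (P N).real {ω | X N k ω = i} = powerLawProb α N i)
    (x : ℝ) :
    Tendsto (fun N : ℕ+ => (P N).real {ω | CollectedBy (M + 1) (fun k => X N k ω)
      ⌊powerLawScale α N * powerLawTime M α x N⌋₊}) atTop (𝓝 (Real.exp (-Real.exp (-x)))) := by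
  have hcont : Continuous fun ε : ℝ => Real.exp (-Real.exp (-(x + ε))) := by fun_prop
  have hcont' : Continuous fun ε : ℝ => Real.exp (-Real.exp (-(x - ε))) := by fun_prop
  have hev : ∀ y ε : ℝ, 0 < ε → ∀ᶠ N : ℕ+ in atTop,
      ε ≤ powerLawTime M α y N ∧ 0 ≤ powerLawTime M α x N ∧ 1 ≤ ε / 2 * ((N : ℕ) : ℝ) := by
    intro y ε hε
    have h : ∀ᶠ N : ℕ in atTop, 1 ≤ ε / 2 * (N : ℝ) :=
      (tendsto_natCast_atTop_atTop.const_mul_atTop (by positivity)).eventually_ge_atTop 1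
    exact tendsto_PNat_val_atTop_atTop.eventually
      (((tendsto_powerLawTime M hα y).eventually_ge_atTop ε).and
        (((tendsto_powerLawTime M hα x).eventually_ge_atTop 0).and h))
  refine tendsto_order.2 ⟨fun a ha => ?_, fun a ha => ?_⟩
  · have h0 : Tendsto (fun ε : ℝ => Real.exp (-Real.exp (-(x - ε)))) (𝓝[>] 0)
        (𝓝 (Real.exp (-Real.exp (-x)))) := by
      simpa using (hcont'.tendsto 0).mono_left nhdsWithin_le_nhds
    obtain ⟨ε, hεa, hε⟩ := ((h0.eventually_const_lt ha).and self_mem_nhdsWithin).exists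
    have hε : 0 < ε := hε
    -- Lower bound: Poissonize slightly early, at `x - ε`, so that the Poisson number of draws
    -- rarely exceeds the fixed one. The upper bound uses `x + ε`.
    have hlim := ((tendsto_prod_powerLawTime M hα (x - ε)).sub
      (tendsto_exp_neg_powerLawTime M hα (x - ε) hε)).comp tendsto_PNat_val_atTop_atTop
    rw [sub_zero] at hlim
    filter_upwards [hlim.eventually_const_lt hεa, hev (x - ε) ε hε] with N h1 h2
    have e : powerLawTime M α (x - ε) N + ε = powerLawTime M α x N := by
      unfold powerLawTime
      ring
    have h3 := (measureReal_collectedBy_bounds M hα N.2 (hX N) (hI N) (hp N) hε h2.1 h2.2.2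
      ⌊powerLawScale α N * powerLawTime M α x N⌋₊).2 (by
        rw [e]
        exact (Nat.sub_one_lt_floor _).le)
    simp only [Function.comp_apply] at h1
    change a < _ - _ at h1
    exact h1.trans_le (sub_le_iff_le_add.2 h3)
  · have h0 : Tendsto (fun ε : ℝ => Real.exp (-Real.exp (-(x + ε)))) (𝓝[>] 0)
        (𝓝 (Real.exp (-Real.exp (-x)))) := by
      simpa using (hcont.tendsto 0).mono_left nhdsWithin_le_nhds
    obtain ⟨ε, hεa, hε⟩ := ((h0.eventually_lt_const ha).and self_mem_nhdsWithin).exists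
    have hε : 0 < ε := hε
    have hlim := ((tendsto_prod_powerLawTime M hα (x + ε)).add
      (tendsto_exp_neg_powerLawTime M hα (x + ε) hε)).comp tendsto_PNat_val_atTop_atTop
    rw [add_zero] at hlim
    filter_upwards [hlim.eventually_lt_const hεa, hev (x + ε) ε hε] with N h1 h2
    have e : powerLawTime M α (x + ε) N - ε = powerLawTime M α x N := by
      unfold powerLawTime
      ring
    have hC : 0 ≤ powerLawScale α N := (Nat.cast_nonneg _).trans (natCast_le_powerLawScale hα N)
    have h3 := (measureReal_collectedBy_bounds M hα N.2 (hX N) (hI N) (hp N) hε h2.1 h2.2.2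
      ⌊powerLawScale α N * powerLawTime M α x N⌋₊).1 (by
        rw [e]
        exact Nat.floor_le (mul_nonneg hC h2.2.1))
    simp only [Function.comp_apply] at h1
    change _ + _ < a at h1
    exact h3.trans_lt h1

/-! ### Conclusion -/

theorem gumbelMeasure_real_Iic (x : ℝ) :
    gumbelMeasure.real (Set.Iic x) = Real.exp (-Real.exp (-x)) := by
  have h0 : Tendsto gumbelCDF atBot (𝓝 0) :=
    Real.tendsto_exp_atBot.comp (tendsto_neg_atTop_atBot.comp
      (Real.tendsto_exp_atTop.comp tendsto_neg_atBot_atTop))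
  rw [measureReal_def, gumbelMeasure, StieltjesFunction.measure_Iic _ h0, sub_zero,
    ENNReal.toReal_ofReal]
  · rfl
  · exact (Real.exp_pos _).le

theorem mainTheorem8 (m : ℕ) (hm : 1 ≤ m) (α : ℝ) (hα : 0 < α)
    {Ω : ℕ+ → Type*} [∀ N, MeasurableSpace (Ω N)]
    (P : ∀ N, Measure (Ω N)) [∀ N, IsProbabilityMeasure (P N)]
    (X : ∀ N : ℕ+, ℕ → Ω N → Fin N)
    (hX_meas : ∀ N k, Measurable (X N k))
    (hX_indep : ∀ N, iIndepFun (X N) (P N))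
    (hX_law : ∀ (N : ℕ+) (k : ℕ) (i : Fin N), (P N).real {ω | X N k ω = i} = powerLawProb α N i)
    {Ω' : Type*} [MeasurableSpace Ω'] (P' : Measure Ω') [IsProbabilityMeasure P']
    (G : Ω' → ℝ) (hG : HasLaw G gumbelMeasure P') :
    (∀ N, ∀ᵐ ω ∂(P N), ∃ n : ℕ, CollectedBy m (fun k => X N k ω) n) ∧
    TendstoInDistribution
      (fun (N : ℕ+) ω =>
        ((collectionTime m (fun k => X N k ω) : ℝ) - powerLawCenter m α N) / powerLawScale α N)
      atTop G P P' := by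
  have hae : ∀ N, ∀ᵐ ω ∂(P N), ∃ n : ℕ, CollectedBy m (fun k => X N k ω) n := fun N =>
    ae_exists_collectedBy (hX_meas N) (hX_indep N) (powerLawProb_pos α) (hX_law N) m
  refine ⟨hae, ?_⟩
  have hmeas : ∀ N : ℕ+, Measurable fun ω =>
      ((collectionTime m (fun k => X N k ω) : ℝ) - powerLawCenter m α N) / powerLawScale α N :=
    fun N => ((measurable_from_nat.comp
      (measurable_collectionTime (hX_meas N) m)).sub_const _).div_const _
  refine ⟨fun N => (hmeas N).aemeasurable, hG.aemeasurable,
    tendsto_probabilityMeasure_of_tendsto_Iic fun x => ?_⟩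
  obtain ⟨M, rfl⟩ : ∃ M, m = M + 1 := ⟨m - 1, by omega⟩
  change Tendsto (fun N : ℕ+ => ((P N).map _).real (Set.Iic x)) atTop
    (𝓝 ((P'.map G).real (Set.Iic x)))
  rw [hG.map_eq, gumbelMeasure_real_Iic]
  refine (tendsto_measureReal_collectedBy M hα hX_meas hX_indep hX_law x).congr' ?_
  -- A nonnegative time is needed because the natural floor of a negative number is `0`.
  filter_upwards [tendsto_PNat_val_atTop_atTop.eventually
    ((tendsto_powerLawTime M hα x).eventually_ge_atTop 0)] with N hN
  rw [map_measureReal_apply (hmeas N) measurableSet_Iic]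
  refine measureReal_congr ?_
  -- The two events agree only where the collection completes; elsewhere the time has its default
  -- value `0`.
  filter_upwards [hae N] with ω hω
  have hC : 0 < powerLawScale α N :=
    lt_of_lt_of_le (by exact_mod_cast N.2) (natCast_le_powerLawScale hα N)
  have e : powerLawScale α N * powerLawTime M α x N
      = x * powerLawScale α N + powerLawCenter (M + 1) α N := by
    rw [powerLawTime, powerLawCenter, Nat.add_sub_cancel]
    push_cast
    ring
  refine propext ?_
  change CollectedBy (M + 1) (fun k => X N k ω) ⌊powerLawScale α N * powerLawTime M α x N⌋₊ ↔
    ((collectionTime (M + 1) (fun k => X N k ω) : ℝ) - powerLawCenter (M + 1) α N)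
      / powerLawScale α N ≤ x
  rw [← collectionTime_le_iff hω, Nat.le_floor_iff (mul_nonneg hC.le hN), e, div_le_iff₀ hC,
    sub_le_iff_le_add]
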